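/- **Setting.** A spectral triple $(\mathcal A,\mathcal H,D)$ consists of a unital complex $*$-algebra $\mathcal A$ with a unital $*$-representation by bounded operators on a Hilbert space $\mathcal H$ and a densely defined selfadjoint operator $D$ on $\mathcal H$ with compact resolvent, such that every $a\in\mathcal A$ preserves $\mathrm{Dom}\,D$ and $[D,a]$ extends to a bounded operator. It is *even* if there is given a bounded operator $\gamma=\gamma^*$ with $\gamma^2=1$, $[\gamma,a]=0$ for $a\in\mathcal A$, and $\gamma D=-D\gamma$. It is *real* of KR-dimension $n$ if there is given an antiunitary $J$ with $J^2=\epsilon$, $JD=\epsilon' DJ$, and $[a,Jb^*J^{-1}]=0$, $[[D,a],Jb^*J^{-1}]=0$ for all $a,b\in\mathcal A$; in the even real case of (even) KR-dimension $n$ one requires also $J\gamma=\epsilon''\gamma J$. The signs depend on $n$ modulo $8$ in the usual way; for $n=3$: $J^2=-1$, $JD=DJ$; for $n=2$: $J^2=-1$, $JD=DJ$, $J\gamma=-\gamma J$. Equalities between unbounded operators include equality of the domains. Two even spectral triples $(\mathcal B,\mathcal H_1,D_1,\gamma_1)$, $(\mathcal B,\mathcal H_2,D_2,\gamma_2)$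 are *pairwise real* of KR-dimension $n$ through antiunitaries $j_1:\mathcal H_1\to\mathcal H_2$, $j_2:\mathcal H_2\to\mathcal H_1$ if the operators $D_1\oplus D_2$, $\gamma_1\oplus\gamma_2$ and $J(x,y)=(j_2y,j_1x)$ on $\mathcal H_1\oplus\mathcal H_2$ satisfy all these conditions on an even real spectral triple of KR-dimension $n$. Let $(\mathcal A,\mathcal H,D,J)$ be a real spectral triple of KR-dimension $3$ that is $U(1)$-equivariant: $U(1)$ acts on $\mathcal A$ by $*$-automorphisms $\alpha_z$, and on $\mathcal H$ by a strongly continuous unitary representation $U$ with $U(z)aU(z)^{-1}=\alpha_z(a)$ for $a\in\mathcal A$, $U(z)D=DU(z)$, $U(z)J=JU(z)$. Let $\delta$ be the generator, $U(e^{it})=e^{it\delta}$, and let $\mathcal B\subset\mathcal A$ be the subalgebra of $U(1)$-invariant elements. Assume that the triple is *projectable*: there is given a bounded operator $\Gamma=\Gamma^*$ with $\Gamma^2=1$, $[\Gamma,a]=0$ for all $a\in\mathcal A$, $\Gamma J=-J\Gamma$, $\Gamma\delta=\delta\Gamma$ and $\Gamma\,\mathrm{Dom}\,D\subset\mathrm{Dom}\,D$;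 put $D_h=\tfrac12\Gamma[\Gamma,D]$ on $\mathrm{Dom}\,D$. Assume that it has *fibres of constant length* $2\pi\ell$, $\ell>0$: the operator $Z=D-D_h-\tfrac1\ell\Gamma\delta$, defined on $\mathrm{Dom}\,D\cap\mathrm{Dom}\,\delta$, extends to a bounded operator that commutes with $Ja^*J^{-1}$ for all $a\in\mathcal A$. For $k\in\mathbb Z$ let $\mathcal H_k=\{x\in\mathcal H:\delta x=kx\}$. Then $\mathcal H_k$ is a closed subspace preserved by $\mathcal B$, $\Gamma$ and $D_h$, and $J\mathcal H_k=\mathcal H_{-k}$. Let $D_k$ (with domain $\mathrm{Dom}\,D\cap\mathcal H_k$), $\gamma_k$ and $j_k:\mathcal H_k\to\mathcal H_{-k}$ be the restrictions of $D_h$, $\Gamma$ and $J$ to $\mathcal H_k$. **Proposition.** For all $k\in\mathbb Z$, $$\gamma_kD_k=-D_k\gamma_k,\qquad j_kD_k=D_{-k}j_k,\qquad j_k\gamma_k=-\gamma_{-k}j_k .$$ The data $(\mathcal B,\mathcal H_0,D_0,\gamma_0,j_0)$ form an even real spectral triple of KR-dimension $2$. For every $k\neq0$, $(\mathcal B,\mathcal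 H_k,D_k,\gamma_k)$ is an even spectral triple, and $(\mathcal B,\mathcal H_k,D_k,\gamma_k)$ and $(\mathcal B,\mathcal H_{-k},D_{-k},\gamma_{-k})$ are pairwise real of KR-dimension $2$ through $j_k$ and $j_{-k}$. -/

import Mathlib

open scoped ComplexConjugate InnerProductSpace

noncomputable section

namespace NCBundle

/-! ## Unbounded operators -/

section Unbounded

variable {E F : Type*} [NormedAddCommGroup E] [InnerProductSpace ℂ E]
  [NormedAddCommGroup F] [InnerProductSpace ℂ F]

/-- The equality of unbounded operators `D₂ S = c S D₁`, where `S` is everywhere defined and `c` is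
a nonzero scalar (in all uses `c = 1` or `c = -1`); it includes the equality of the domains. -/
def Intertwines (S : E → F) (D₁ : E →ₗ.[ℂ] E) (D₂ : F →ₗ.[ℂ] F) (c : ℤ) : Prop :=
  (∀ x : E, S x ∈ D₂.domain ↔ x ∈ D₁.domain) ∧
    ∀ (x : D₁.domain) (h : S x ∈ D₂.domain), D₂ ⟨S x, h⟩ = c • S (D₁ x)

/-- The bounded operator `T` is (the extension of) the commutator `[D, A]`: the bounded operator
`A` maps the domain of `D` to itself, and `D A x - A D x = T x` on the domain of `D`. -/
def IsCommutator (D : E →ₗ.[ℂ] E) (A T : E →L[ℂ] E) : Prop :=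
  ∀ x : D.domain, ∃ h : A x ∈ D.domain, D ⟨A x, h⟩ - A (D x) = T x

/-- `D` has compact resolvent: for some `z` the operator `D - z` is a bijection of the domain of
`D` onto the space, with a compact (bounded) inverse `R`. -/
def HasCompactResolvent (D : E →ₗ.[ℂ] E) : Prop :=
  ∃ (z : ℂ) (R : E →L[ℂ] E), IsCompactOperator R ∧
    (∀ x : E, ∃ h : R x ∈ D.domain, D ⟨R x, h⟩ - z • R x = x) ∧
    ∀ x : D.domain, R (D x - z • (x : E)) = x

end Unbounded

/-! ## Spectral triples -/

/-- The sign `ε` in `J² = ε` in KR-dimension `n` mod `8`. -/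
def krEps (n : ℕ) : ℤ := if n % 8 = 2 ∨ n % 8 = 3 ∨ n % 8 = 4 ∨ n % 8 = 5 then -1 else 1

/-- The sign `ε'` in `J D = ε' D J` in KR-dimension `n` mod `8`. -/
def krEps' (n : ℕ) : ℤ := if n % 4 = 1 then -1 else 1

/-- The sign `ε''` in `J γ = ε'' γ J` in even KR-dimension `n` mod `8`. -/
def krEps'' (n : ℕ) : ℤ := if n % 4 = 2 then -1 else 1

section Triples

variable {𝒜 : Type*} [Ring 𝒜] [StarRing 𝒜] [Algebra ℂ 𝒜]
  {H H' : Type*} [NormedAddCommGroup H] [InnerProductSpace ℂ H] [CompleteSpace H]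
  [NormedAddCommGroup H'] [InnerProductSpace ℂ H'] [CompleteSpace H']

/-- `(𝒜, H, D)` is a spectral triple, `𝒜` acting on `H` through `π`: the operator `D` is
(densely defined and) selfadjoint, has compact resolvent, and the commutators `[D, π a]` are
bounded. -/
structure IsSpectralTriple (π : 𝒜 →⋆ₐ[ℂ] (H →L[ℂ] H)) (D : H →ₗ.[ℂ] H) : Prop where
  dense_domain : Dense (D.domain : Set H)
  selfAdjoint : IsSelfAdjoint D
  compact_resolvent : HasCompactResolvent D
  bounded_commutator : ∀ a : 𝒜, ∃ T : H →L[ℂ] H, IsCommutator D (π a) T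

/-- `(𝒜, H, D, γ)` is an even spectral triple. -/
structure IsEvenSpectralTriple (π : 𝒜 →⋆ₐ[ℂ] (H →L[ℂ] H)) (D : H →ₗ.[ℂ] H) (γ : H →L[ℂ] H) :
    Prop extends IsSpectralTriple π D where
  grading_selfAdjoint : IsSelfAdjoint γ
  grading_sq : ∀ x, γ (γ x) = x
  grading_comm : ∀ (a : 𝒜) (x : H), γ (π a x) = π a (γ x)
  grading_anticomm : Intertwines γ D D (-1)

/-- `(𝒜, H, D, J)` is a spectral triple with a real structure `J` (an antiunitary operator) obeying
the signs `ε`, `ε'` of KR-dimension `n`, the commutant property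
`[π a, J π(b^*) J⁻¹] = 0` and the order one condition `[[D, π a], J π(b^*) J⁻¹] = 0`. -/
structure IsRealSpectralTriple (n : ℕ) (π : 𝒜 →⋆ₐ[ℂ] (H →L[ℂ] H)) (D : H →ₗ.[ℂ] H)
    (J : H ≃ₗᵢ⋆[ℂ] H) : Prop extends IsSpectralTriple π D where
  real_sq : ∀ x, J (J x) = krEps n • x
  real_dirac : Intertwines J D D (krEps' n)
  commutant : ∀ (a b : 𝒜) (x : H),
    π a (J (π (star b) (J.symm x))) = J (π (star b) (J.symm (π a x)))
  order_one : ∀ (a b : 𝒜) (T : H →L[ℂ] H), IsCommutator D (π a) T → ∀ x : H,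
    T (J (π (star b) (J.symm x))) = J (π (star b) (J.symm (T x)))

/-- `(𝒜, H, D, γ, J)` is an even real spectral triple of (even) KR-dimension `n`. -/
structure IsEvenRealSpectralTriple (n : ℕ) (π : 𝒜 →⋆ₐ[ℂ] (H →L[ℂ] H)) (D : H →ₗ.[ℂ] H)
    (γ : H →L[ℂ] H) (J : H ≃ₗᵢ⋆[ℂ] H) : Prop
    extends IsEvenSpectralTriple π D γ, IsRealSpectralTriple n π D J where
  even_dim : Even n
  real_grading : ∀ x, J (γ x) = krEps'' n • γ (J x)

/-- The even spectral triples `(𝒜, H, D, γ)` and `(𝒜, H', D', γ')` are pairwise real of KR-dimension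
`n`, through the antiunitaries `j : H → H'` and `j' : H' → H`. These are, written out on the two
summands, the conditions for `H ⊕ H'` with `D ⊕ D'`, `γ ⊕ γ'` and the antiunitary operator
`(x, y) ↦ (j' y, j x)` to be an even real spectral triple of KR-dimension `n`. -/
structure IsPairwiseReal (n : ℕ)
    (π : 𝒜 →⋆ₐ[ℂ] (H →L[ℂ] H)) (D : H →ₗ.[ℂ] H) (γ : H →L[ℂ] H)
    (π' : 𝒜 →⋆ₐ[ℂ] (H' →L[ℂ] H')) (D' : H' →ₗ.[ℂ] H') (γ' : H' →L[ℂ] H')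
    (j : H ≃ₗᵢ⋆[ℂ] H') (j' : H' ≃ₗᵢ⋆[ℂ] H) : Prop where
  even_left : IsEvenSpectralTriple π D γ
  even_right : IsEvenSpectralTriple π' D' γ'
  even_dim : Even n
  real_sq_left : ∀ x, j' (j x) = krEps n • x
  real_sq_right : ∀ x, j (j' x) = krEps n • x
  real_dirac_left : Intertwines j D D' (krEps' n)
  real_dirac_right : Intertwines j' D' D (krEps' n)
  real_grading_left : ∀ x, j (γ x) = krEps'' n • γ' (j x)
  real_grading_right : ∀ x, j' (γ' x) = krEps'' n • γ (j' x)
  commutant_left : ∀ (a b : 𝒜) (x : H),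
    π a (j' (π' (star b) (j'.symm x))) = j' (π' (star b) (j'.symm (π a x)))
  commutant_right : ∀ (a b : 𝒜) (x : H'),
    π' a (j (π (star b) (j.symm x))) = j (π (star b) (j.symm (π' a x)))
  order_one_left : ∀ (a b : 𝒜) (T : H →L[ℂ] H), IsCommutator D (π a) T → ∀ x : H,
    T (j' (π' (star b) (j'.symm x))) = j' (π' (star b) (j'.symm (T x)))
  order_one_right : ∀ (a b : 𝒜) (T : H' →L[ℂ] H'), IsCommutator D' (π' a) T → ∀ x : H',
    T (j (π (star b) (j.symm x))) = j (π (star b) (j.symm (T x)))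

end Triples

/-! ## Unitary actions of the circle -/

section Circle

variable {H : Type*} [NormedAddCommGroup H] [InnerProductSpace ℂ H]

/-- The generator `δ` of a unitary action `U` of `U(1)`, so that `U(e^{it}) = e^{itδ}`:
`δ x = -i d/dt U(e^{it}) x` at `t = 0`, defined whenever this derivative exists. -/
def generator (U : Circle →* (H ≃ₗᵢ[ℂ] H)) : H →ₗ.[ℂ] H where
  domain :=
    { carrier := {x | DifferentiableAt ℝ (fun t : ℝ => U (Circle.exp t) x) 0}
      add_mem' := fun {x y} hx hy => by
        have h := DifferentiableAt.fun_add (𝕜 := ℝ) hx hy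
        simpa using h
      zero_mem' := by simp
      smul_mem' := fun c x hx => by
        have h := DifferentiableAt.fun_const_smul (𝕜 := ℝ) hx c
        simpa using h }
  toFun :=
    { toFun := fun x => -Complex.I • deriv (fun t : ℝ => U (Circle.exp t) (x : H)) 0
      map_add' := fun x y => by
        have h := deriv_add (show DifferentiableAt ℝ (fun t : ℝ => U (Circle.exp t) (x : H)) 0
          from x.2) (show DifferentiableAt ℝ (fun t : ℝ => U (Circle.exp t) (y : H)) 0 from y.2)
        rw [← smul_add, ← h]
        congr 2
        funext t
        simp
      map_smul' := fun c x => by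
        have h := deriv_const_smul c
          (show DifferentiableAt ℝ (fun t : ℝ => U (Circle.exp t) (x : H)) 0 from x.2)
        rw [RingHom.id_apply, smul_comm c, ← h]
        congr 2
        funext t
        simp }

/-- The eigenspace of the generator `δ` for the eigenvalue `k`. -/
def weightSpace (U : Circle →* (H ≃ₗᵢ[ℂ] H)) (k : ℤ) : Submodule ℂ H where
  carrier := {x | ∃ h : x ∈ (generator U).domain, generator U ⟨x, h⟩ = (k : ℂ) • x}
  add_mem' := by
    rintro x y ⟨hx, ex⟩ ⟨hy, ey⟩
    refine ⟨add_mem hx hy, ?_⟩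
    have := (generator U).map_add ⟨x, hx⟩ ⟨y, hy⟩
    rw [ex, ey, ← smul_add] at this
    exact this
  zero_mem' := ⟨zero_mem _, by
    rw [smul_zero]
    exact (generator U).map_zero⟩
  smul_mem' := by
    rintro c x ⟨hx, ex⟩
    refine ⟨(generator U).domain.smul_mem c hx, ?_⟩
    have := (generator U).map_smul c ⟨x, hx⟩
    rw [ex, smul_comm] at this
    exact this

theorem mem_weightSpace_iff (U : Circle →* (H ≃ₗᵢ[ℂ] H)) (k : ℤ) (x : H) :
    x ∈ weightSpace U k ↔ ∀ z : Circle, U z x = ((z : ℂ) ^ k) • x := by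
  have hexp : ∀ t : ℝ, ((Circle.exp t : Circle) : ℂ) ^ k
      = Complex.exp ((k : ℂ) * Complex.I * (t : ℂ)) := by
    intro t
    rw [Circle.coe_exp, ← Complex.exp_int_mul]
    ring_nf
  have hlin : ∀ (c : ℂ) (t : ℝ), HasDerivAt (fun t : ℝ => Complex.exp (c * (t : ℂ)))
      (Complex.exp (c * (t : ℂ)) * c) t := by
    intro c t
    have h := ((Complex.ofRealCLM.hasDerivAt (x := t)).const_mul c).cexp
    simpa using h
  constructor
  · rintro ⟨hd, he⟩
    have h0 : HasDerivAt (fun t : ℝ => U (Circle.exp t) x) (((k : ℂ) * Complex.I) • x) 0 := by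
      have h1 : DifferentiableAt ℝ (fun t : ℝ => U (Circle.exp t) x) 0 := hd
      have h2 : -Complex.I • deriv (fun t : ℝ => U (Circle.exp t) x) 0 = (k : ℂ) • x := he
      have h3 : deriv (fun t : ℝ => U (Circle.exp t) x) 0 = ((k : ℂ) * Complex.I) • x := by
        rw [mul_comm, mul_smul, ← h2, smul_smul]
        simp
      rw [← h3]
      exact h1.hasDerivAt
    have h1 : ∀ t : ℝ, HasDerivAt (fun t : ℝ => U (Circle.exp t) x)
        (((k : ℂ) * Complex.I) • U (Circle.exp t) x) t := by
      intro t
      have h2 : HasDerivAt (fun s : ℝ => U (Circle.exp (s - t)) x)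
          (((k : ℂ) * Complex.I) • x) t := by
        have h3 : HasDerivAt (fun t : ℝ => U (Circle.exp t) x)
            (((k : ℂ) * Complex.I) • x) (t - t) := by
          rw [sub_self]
          exact h0
        exact h3.comp_sub_const t t
      have h4 := ((U (Circle.exp t)).toContinuousLinearEquiv.toContinuousLinearMap.restrictScalars
        ℝ).hasFDerivAt.comp_hasDerivAt t h2
      have h5 : (fun s : ℝ => U (Circle.exp s) x)
          = (fun s : ℝ => U (Circle.exp t) (U (Circle.exp (s - t)) x)) := by
        funext s
        have h6 : Circle.exp s = Circle.exp t * Circle.exp (s - t) := by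
          rw [← Circle.exp_add, add_sub_cancel]
        rw [h6, map_mul]
        rfl
      rw [h5, ← map_smul]
      exact h4
    have h2 : ∀ t : ℝ, HasDerivAt (fun t : ℝ =>
        Complex.exp (-((k : ℂ) * Complex.I) * (t : ℂ)) • U (Circle.exp t) x) 0 t := by
      intro t
      have h3 := (hlin (-((k : ℂ) * Complex.I)) t).smul (h1 t)
      have h4 : Complex.exp (-((k : ℂ) * Complex.I) * (t : ℂ)) • ((k : ℂ) * Complex.I) •
          U (Circle.exp t) x + (Complex.exp (-((k : ℂ) * Complex.I) * (t : ℂ)) *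
            -((k : ℂ) * Complex.I)) • U (Circle.exp t) x = 0 := by
        rw [smul_smul, ← add_smul]
        simp
      rw [h4] at h3
      exact h3
    have h3 : ∀ t : ℝ, Complex.exp (-((k : ℂ) * Complex.I) * (t : ℂ)) • U (Circle.exp t) x = x := by
      intro t
      have h4 := is_const_of_deriv_eq_zero (fun t => (h2 t).differentiableAt)
        (fun t => (h2 t).deriv) t 0
      simpa using h4
    intro z
    obtain ⟨t, rfl⟩ := Circle.exp_surjective z
    rw [hexp]
    conv_rhs => rw [← h3 t]
    rw [smul_smul, ← Complex.exp_add]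
    simp
  · intro h
    have h1 : (fun t : ℝ => U (Circle.exp t) x)
        = fun t : ℝ => Complex.exp ((k : ℂ) * Complex.I * (t : ℂ)) • x := by
      funext t
      rw [h, hexp]
    have h2 : HasDerivAt (fun t : ℝ => U (Circle.exp t) x) (((k : ℂ) * Complex.I) • x) 0 := by
      rw [h1]
      simpa using (hlin ((k : ℂ) * Complex.I) 0).smul_const x
    refine ⟨h2.differentiableAt, ?_⟩
    change -Complex.I • deriv (fun t : ℝ => U (Circle.exp t) x) 0 = (k : ℂ) • x
    rw [h2.deriv, smul_smul]
    congr 1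
    linear_combination (-(k : ℂ)) * Complex.I_mul_I

theorem isClosed_weightSpace (U : Circle →* (H ≃ₗᵢ[ℂ] H)) (k : ℤ) :
    IsClosed (weightSpace U k : Set H) := by
  have : (weightSpace U k : Set H) = ⋂ z : Circle, {x | U z x = ((z : ℂ) ^ k) • x} := by
    ext x
    simp [mem_weightSpace_iff]
  rw [this]
  exact isClosed_iInter fun z =>
    isClosed_eq (U z).continuous (continuous_const_smul _)

instance [CompleteSpace H] (U : Circle →* (H ≃ₗᵢ[ℂ] H)) (k : ℤ) :
    CompleteSpace (weightSpace U k) :=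
  (isClosed_weightSpace U k).completeSpace_coe

end Circle

/-! ## Equivariant and projectable triples -/

section Bundle

variable (𝒜 : Type*) [Ring 𝒜] [StarRing 𝒜] [Algebra ℂ 𝒜]
  (H : Type*) [NormedAddCommGroup H] [InnerProductSpace ℂ H] [CompleteSpace H]

/-- A `U(1)`-equivariant real spectral triple of KR-dimension `3` over a unital `*`-algebra `𝒜` with
an action `α` of `U(1)`; the action is implemented by the strongly continuous unitary action `U` on
the Hilbert space. -/
structure EquivariantTriple where
  α : Circle →* (𝒜 ≃⋆ₐ[ℂ] 𝒜)
  π : 𝒜 →⋆ₐ[ℂ] (H →L[ℂ] H)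
  D : H →ₗ.[ℂ] H
  J : H ≃ₗᵢ⋆[ℂ] H
  U : Circle →* (H ≃ₗᵢ[ℂ] H)
  isReal : IsRealSpectralTriple 3 π D J
  continuous_U : ∀ x : H, Continuous fun z : Circle => U z x
  equivariant_π : ∀ (z : Circle) (a : 𝒜) (x : H), U z (π a x) = π (α z a) (U z x)
  equivariant_D : ∀ z : Circle, Intertwines (U z) D D 1
  equivariant_J : ∀ (z : Circle) (x : H), U z (J x) = J (U z x)

/-- A projectable triple: an equivariant triple with a grading `Γ`, such that `[Γ, a] = 0`,
`Γ J = -J Γ`, `Γ δ = δ Γ`, `Γ^* = Γ` and `Γ² = 1`. It is part of the definition that `Γ` preserves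
the domain of `D`, so that the commutator `[Γ, D]` is defined on the domain of `D`. -/
structure ProjectableTriple extends EquivariantTriple 𝒜 H where
  Γ : H →L[ℂ] H
  Γ_domain : ∀ x ∈ D.domain, Γ x ∈ D.domain
  Γ_comm : ∀ (a : 𝒜) (x : H), Γ (π a x) = π a (Γ x)
  Γ_J : ∀ x : H, Γ (J x) = -J (Γ x)
  Γ_δ : Intertwines Γ (generator U) (generator U) 1
  Γ_selfAdjoint : IsSelfAdjoint Γ
  Γ_sq : ∀ x : H, Γ (Γ x) = x

end Bundle

namespace ProjectableTriple

variable {𝒜 : Type*} [Ring 𝒜] [StarRing 𝒜] [Algebra ℂ 𝒜]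
  {H : Type*} [NormedAddCommGroup H] [InnerProductSpace ℂ H] [CompleteSpace H]
  (T : ProjectableTriple 𝒜 H)

/-- The generator `δ` of the action of `U(1)` on the Hilbert space. -/
def δ : H →ₗ.[ℂ] H := generator T.U

/-- The horizontal Dirac operator `D_h = ½ Γ [Γ, D]`, on the domain of `D`. -/
def Dh : H →ₗ.[ℂ] H where
  domain := T.D.domain
  toFun :=
    { toFun := fun x =>
        (1 / 2 : ℂ) • T.Γ (T.Γ (T.D x) - T.D ⟨T.Γ x, T.Γ_domain x x.2⟩)
      map_add' := fun x y => by
        have h : (⟨T.Γ ((x + y : T.D.domain) : H), T.Γ_domain _ (x + y).2⟩ : T.D.domain)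
            = ⟨T.Γ x, T.Γ_domain x x.2⟩ + ⟨T.Γ y, T.Γ_domain y y.2⟩ := by
          ext
          simp
        rw [h, T.D.map_add, T.D.map_add, ← smul_add, ← map_add, map_add T.Γ (T.D x)]
        congr 2
        abel
      map_smul' := fun c x => by
        have h : (⟨T.Γ ((c • x : T.D.domain) : H), T.Γ_domain _ (c • x).2⟩ : T.D.domain)
            = c • ⟨T.Γ x, T.Γ_domain x x.2⟩ := by
          ext
          simp
        rw [h, T.D.map_smul, T.D.map_smul, map_smul, ← smul_sub, map_smul, smul_comm,
          RingHom.id_apply] }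

/-- The fibres have constant length `2πℓ`: with `D_v = (1/ℓ) Γ δ`, the operator
`Z = D - D_h - D_v` is bounded and commutes with the operators `J a^* J⁻¹`. -/
def HasConstantFibreLength (ℓ : ℝ) : Prop :=
  0 < ℓ ∧ ∃ Z : H →L[ℂ] H,
    (∀ (x : H) (hD : x ∈ T.D.domain) (hδ : x ∈ T.δ.domain),
      T.D ⟨x, hD⟩ - T.Dh ⟨x, hD⟩ - ((1 / ℓ : ℝ) : ℂ) • T.Γ (T.δ ⟨x, hδ⟩) = Z x) ∧
    ∀ (a : 𝒜) (x : H),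
      Z (T.J (T.π (star a) (T.J.symm x))) = T.J (T.π (star a) (T.J.symm (Z x)))

/-- `H_k`, the eigenspace of `δ` for the eigenvalue `k`. -/
abbrev Hk (k : ℤ) : Submodule ℂ H := weightSpace T.U k

theorem Γ_mem (k : ℤ) (x : H) (hx : x ∈ T.Hk k) : T.Γ x ∈ T.Hk k := by
  obtain ⟨h, e⟩ := hx
  refine ⟨(T.Γ_δ.1 x).2 h, ?_⟩
  rw [T.Γ_δ.2 ⟨x, h⟩ ((T.Γ_δ.1 x).2 h), e]
  simp

theorem J_mem (k m : ℤ) (h : m = -k) (x : H) (hx : x ∈ T.Hk k) : T.J x ∈ T.Hk m := by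
  subst h
  rw [mem_weightSpace_iff] at hx ⊢
  intro z
  rw [T.equivariant_J, hx z, LinearIsometryEquiv.map_smulₛₗ]
  congr 1
  rw [map_zpow₀, zpow_neg, ← inv_zpow, ← Circle.coe_inv, Circle.coe_inv_eq_conj]

theorem J_symm_mem (k m : ℤ) (h : m = -k) (x : H) (hx : x ∈ T.Hk m) :
    T.J.symm x ∈ T.Hk k := by
  have h1 : T.J.symm x = -T.J x := by
    rw [LinearIsometryEquiv.symm_apply_eq, map_neg, T.isReal.real_sq]
    simp [krEps]
  rw [h1]
  exact neg_mem (T.J_mem m k (by omega) x hx)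

theorem D_mem (k : ℤ) (x : T.D.domain) (hx : (x : H) ∈ T.Hk k) : T.D x ∈ T.Hk k := by
  rw [mem_weightSpace_iff] at hx ⊢
  intro z
  have h := (T.equivariant_D z).2 x (((T.equivariant_D z).1 x).2 x.2)
  rw [one_smul] at h
  rw [← h, ← T.D.map_smul]
  congr 1
  ext
  simp [hx z]

theorem Dh_mem (k : ℤ) (x : T.D.domain) (hx : (x : H) ∈ T.Hk k) : T.Dh x ∈ T.Hk k :=
  Submodule.smul_mem _ _ (T.Γ_mem k _ (sub_mem (T.Γ_mem k _ (T.D_mem k x hx))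
    (T.D_mem k _ (T.Γ_mem k _ hx))))

/-- `D_k`, the restriction of `D_h` to `H_k`. -/
def Dk (k : ℤ) : T.Hk k →ₗ.[ℂ] T.Hk k where
  domain := T.D.domain.comap (T.Hk k).subtype
  toFun :=
    { toFun := fun x => ⟨T.Dh ⟨(x : T.Hk k), x.2⟩, T.Dh_mem k _ (x : T.Hk k).2⟩
      map_add' := fun x y => Subtype.ext (T.Dh.map_add ⟨(x : T.Hk k), x.2⟩ ⟨(y : T.Hk k), y.2⟩)
      map_smul' := fun c x => Subtype.ext (T.Dh.map_smul c ⟨(x : T.Hk k), x.2⟩) }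

/-- `γ_k`, the restriction of `Γ` to `H_k`. -/
def γk (k : ℤ) : T.Hk k →L[ℂ] T.Hk k := T.Γ.restrict (T.Γ_mem k)

/-- `j_k`, the restriction of `J` to a map `H_k → H_m`, where `m = -k`. -/
def jk (k m : ℤ) (h : m = -k) : T.Hk k ≃ₗᵢ⋆[ℂ] T.Hk m where
  toFun x := ⟨T.J x, T.J_mem k m h x x.2⟩
  invFun x := ⟨T.J.symm x, T.J_symm_mem k m h x x.2⟩
  left_inv x := by ext; simp
  right_inv x := by ext; simp
  map_add' x y := by ext; simp
  map_smul' c x := by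
    ext
    exact T.J.map_smulₛₗ c (x : H)
  norm_map' x := T.J.norm_map x

variable [StarModule ℂ 𝒜]

/-- The subalgebra `ℬ` of `U(1)`-invariant elements of `𝒜`. -/
def invariants : StarSubalgebra ℂ 𝒜 where
  carrier := {a | ∀ z : Circle, T.α z a = a}
  mul_mem' := fun ha hb z => by rw [map_mul, ha z, hb z]
  add_mem' := fun ha hb z => by rw [map_add, ha z, hb z]
  algebraMap_mem' := fun c z => by
    rw [Algebra.algebraMap_eq_smul_one, map_smul, map_one]
  star_mem' := fun {a} ha z => by rw [map_star, ha z]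

theorem π_mem (b : T.invariants) (k : ℤ) (x : H) (hx : x ∈ T.Hk k) :
    T.π (b : 𝒜) x ∈ T.Hk k := by
  rw [mem_weightSpace_iff] at hx ⊢
  intro z
  rw [T.equivariant_π, b.2 z, hx z, map_smul]

/-- The representation of `ℬ` on `H_k`. -/
def πk (k : ℤ) : T.invariants →⋆ₐ[ℂ] (T.Hk k →L[ℂ] T.Hk k) where
  toFun b := (T.π (b : 𝒜)).restrict (T.π_mem b k)
  map_one' := by ext x; simp
  map_mul' a b := by ext x; simp
  map_zero' := by ext x; simp
  map_add' a b := by ext x; simp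
  commutes' c := by ext x; simp [Algebra.algebraMap_eq_smul_one]
  map_star' b := by
    rw [ContinuousLinearMap.star_eq_adjoint, ContinuousLinearMap.eq_adjoint_iff]
    intro x y
    have h := ContinuousLinearMap.adjoint_inner_left (T.π (b : 𝒜)) (y : H) (x : H)
    rw [← ContinuousLinearMap.star_eq_adjoint, ← map_star] at h
    exact h

end ProjectableTriple

end NCBundle

end

/-! Since `Γ² = 1`, `D_h = ½(D - ΓDΓ)` is the part of `D` that anticommutes with `Γ`. The relations
with `γ_k` and `j_k` follow at once: conjugation by `Γ` swaps the two terms, and `J` commutes with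
`D` and, the two signs cancelling, with `ΓDΓ`.

The analytic content is that `D_k` is selfadjoint with compact resolvent. On `H_k` the vertical
operator `(1/ℓ)Γδ` is the bounded operator `(k/ℓ)Γ`, so constant fibre length makes `D = D_h + C`
there with `C` bounded (`HasConstantFibreLength.exists_D_eq`). By equivariance a resolvent `R = (D -
z)⁻¹` and its adjoint preserve `H_k`. This gives density of `Dom D ∩ H_k` and lets the adjoint
domain be computed inside `H_k` (`IsResolvent.dense_domain_comap`,
`IsResolvent.mem_domain_of_inner`); the bounded symmetric perturbation does not change that domain.
Compactness passes from `R` to `Q = (D_k - i)⁻¹` by the resolvent identity `Q = R(1 + (C + i -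
z)Q)`.

For order one, `[D_h, a] = ½([D, a] - Γ[D, a]Γ)`, and `Γ` commutes with every `JbJ⁻¹`, again by
cancellation of two signs. -/

noncomputable section

namespace NCBundle

/-! ### Selfadjoint operators and their resolvents -/

section Resolvent

variable {E : Type*} [NormedAddCommGroup E] [InnerProductSpace ℂ E]

/-- The bounded operator `R` is the resolvent `(D - z)⁻¹`. -/
structure IsResolvent (D : E →ₗ.[ℂ] E) (z : ℂ) (R : E →L[ℂ] E) : Prop where
  right : ∀ x : E, ∃ h : R x ∈ D.domain, D ⟨R x, h⟩ - z • R x = x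
  left : ∀ x : D.domain, R (D x - z • (x : E)) = x

theorem inner_apply_left_of_isSelfAdjoint [CompleteSpace E] {D : E →ₗ.[ℂ] E} (hD : IsSelfAdjoint D)
    (x y : D.domain) : ⟪D x, (y : E)⟫_ℂ = ⟪(x : E), D y⟫_ℂ := by
  have h := LinearPMap.adjoint_isFormalAdjoint hD.dense_domain
  rw [LinearPMap.isSelfAdjoint_def.1 hD] at h
  exact h x y

/-- The form in which `D = D*` is used: a weak solution of `D y = w` is a genuine one. -/
theorem exists_apply_eq_of_isSelfAdjoint [CompleteSpace E] {D : E →ₗ.[ℂ] E} (hD : IsSelfAdjoint D)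
    {y w : E} (h : ∀ x : D.domain, ⟪w, (x : E)⟫_ℂ = ⟪y, D x⟫_ℂ) :
    ∃ hy : y ∈ D.domain, D ⟨y, hy⟩ = w := by
  have hy : y ∈ D.domain := by
    rw [← LinearPMap.isSelfAdjoint_def.1 hD]
    exact LinearPMap.mem_adjoint_domain_of_exists y ⟨w, h⟩
  refine ⟨hy, hD.dense_domain.eq_of_inner_left ℂ fun v hv => ?_⟩
  rw [h ⟨v, hv⟩]
  exact inner_apply_left_of_isSelfAdjoint hD ⟨y, hy⟩ ⟨v, hv⟩

/-- Symmetry already gives `D ≤ D*`, so only the inclusion of the adjoint domain in the domain of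
`D` is left to check. -/
theorem isSelfAdjoint_of_symmetric [CompleteSpace E] {D : E →ₗ.[ℂ] E}
    (hdense : Dense (D.domain : Set E))
    (hsymm : ∀ x y : D.domain, ⟪D x, (y : E)⟫_ℂ = ⟪(x : E), D y⟫_ℂ)
    (hdom : ∀ y w : E, (∀ x : D.domain, ⟪D x, y⟫_ℂ = ⟪(x : E), w⟫_ℂ) → y ∈ D.domain) :
    IsSelfAdjoint D := by
  rw [LinearPMap.isSelfAdjoint_def]
  refine le_antisymm ?_ (LinearPMap.IsFormalAdjoint.le_adjoint hdense hsymm)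
  have hle := LinearPMap.IsFormalAdjoint.le_adjoint hdense hsymm
  have h := LinearPMap.adjoint_isFormalAdjoint hdense
  exact ⟨fun y hy => hdom y (D.adjoint ⟨y, hy⟩) fun x => h.symm x ⟨y, hy⟩,
    fun x y hxy => (hle.2 hxy.symm).symm⟩

/-! ### Subspaces invariant under a resolvent and its adjoint -/

namespace IsResolvent

variable {D : E →ₗ.[ℂ] E} {z : ℂ} {R : E →L[ℂ] E}

theorem adjoint [CompleteSpace E] (hD : IsSelfAdjoint D) (hR : IsResolvent D z R) :
    IsResolvent D (conj z) (ContinuousLinearMap.adjoint R) := by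
  constructor
  · intro y
    have h : ∀ x : D.domain, ⟪y + conj z • ContinuousLinearMap.adjoint R y, (x : E)⟫_ℂ
        = ⟪ContinuousLinearMap.adjoint R y, D x⟫_ℂ := by
      intro x
      have h1 := congrArg (fun v => ⟪y, v⟫_ℂ) (hR.left x)
      simp only [map_sub, map_smul, inner_sub_right, inner_smul_right] at h1
      simp only [inner_add_left, inner_smul_left, ContinuousLinearMap.adjoint_inner_left, ← h1,
        Complex.conj_conj]
      ring
    obtain ⟨hy, e⟩ := exists_apply_eq_of_isSelfAdjoint hD h
    exact ⟨hy, by rw [e, add_sub_cancel_right]⟩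
  · intro x
    refine ext_inner_right ℂ fun y => ?_
    obtain ⟨h, e⟩ := hR.right y
    have h1 := inner_apply_left_of_isSelfAdjoint hD x ⟨R y, h⟩
    rw [ContinuousLinearMap.adjoint_inner_left, inner_sub_left, h1, inner_smul_left,
      Complex.conj_conj]
    conv_rhs => rw [← e]
    rw [inner_sub_right, inner_smul_right]

theorem apply_comm (hR : IsResolvent D z R) {U : E ≃ₗᵢ[ℂ] E} (hU : Intertwines U D D 1) (x : E) :
    R (U x) = U (R x) := by
  obtain ⟨h, e⟩ := hR.right x
  have h1 := hU.2 ⟨R x, h⟩ ((hU.1 _).2 h)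
  have h2 := hR.left ⟨U (R x), (hU.1 _).2 h⟩
  rw [h1, one_smul] at h2
  have h3 : U (D ⟨R x, h⟩) - z • U (R x) = U x := by
    rw [← map_smul, ← map_sub, e]
  rwa [h3] at h2

variable [CompleteSpace E] {K : Submodule ℂ E}

/-- If `y ∈ K` is orthogonal to `Dom D ∩ K`, the test vector `R R* y` gives `‖R* y‖² = 0`, and `R*`
is injective, being the resolvent at `conj z`. -/
theorem dense_domain_comap [CompleteSpace K] (hD : IsSelfAdjoint D) (hR : IsResolvent D z R)
    (hK : ∀ x ∈ K, R x ∈ K) (hK' : ∀ x ∈ K, ContinuousLinearMap.adjoint R x ∈ K) :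
    Dense (D.domain.comap K.subtype : Set K) := by
  rw [Submodule.dense_iff_topologicalClosure_eq_top,
    Submodule.topologicalClosure_eq_top_iff, Submodule.eq_bot_iff]
  intro y hy
  rw [Submodule.mem_orthogonal] at hy
  have h0 : ContinuousLinearMap.adjoint R (y : E) = 0 := by
    have h1 := hy ⟨R (ContinuousLinearMap.adjoint R (y : E)), hK _ (hK' _ y.2)⟩ (hR.right _).1
    rw [Submodule.coe_inner] at h1
    rw [← inner_self_eq_zero (𝕜 := ℂ), ContinuousLinearMap.adjoint_inner_right]
    exact h1
  obtain ⟨h, e⟩ := (hR.adjoint hD).right (y : E)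
  ext
  rw [← e]
  simp only [h0, smul_zero, sub_zero]
  exact D.map_zero

/-- The weak equation `D y = w` is tested only on `Dom D ∩ K`, so selfadjointness of `D` does not
apply directly. Formally `(D - conj z) y = w - conj z • y`, hence `y` should be `R* (w - conj z •
y)`. Both sides lie in `K`, and the test vectors `R u`, `u ∈ K`, suffice to identify them. -/
theorem mem_domain_of_inner (hD : IsSelfAdjoint D) (hR : IsResolvent D z R)
    (hK : ∀ x ∈ K, R x ∈ K) (hK' : ∀ x ∈ K, ContinuousLinearMap.adjoint R x ∈ K) {y w : E}
    (hy : y ∈ K) (hw : w ∈ K) (h : ∀ x : D.domain, (x : E) ∈ K → ⟪D x, y⟫_ℂ = ⟪(x : E), w⟫_ℂ) :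
    y ∈ D.domain := by
  have hv := hK' _ (sub_mem hw (K.smul_mem (conj z) hy))
  have e : y = ContinuousLinearMap.adjoint R (w - conj z • y) := by
    have h1 : ∀ u ∈ K, ⟪u, y - ContinuousLinearMap.adjoint R (w - conj z • y)⟫_ℂ = 0 := by
      intro u hu
      obtain ⟨hd, e⟩ := hR.right u
      have h2 := h ⟨R u, hd⟩ (hK u hu)
      have h3 : ⟪u, y⟫_ℂ = ⟪D ⟨R u, hd⟩, y⟫_ℂ - conj z * ⟪R u, y⟫_ℂ := by
        conv_lhs => rw [← e]
        rw [inner_sub_left, inner_smul_left]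
      rw [inner_sub_right, ContinuousLinearMap.adjoint_inner_right, inner_sub_right, ← h2,
        inner_smul_right, h3, sub_self]
    rw [← sub_eq_zero, ← inner_self_eq_zero (𝕜 := ℂ)]
    exact h1 _ (sub_mem hy hv)
  rw [e]
  exact ((hR.adjoint hD).right _).1

end IsResolvent

/-! ### The resolvent at `i`, and compactness -/

theorem norm_sq_sub_I_smul [CompleteSpace E] {D : E →ₗ.[ℂ] E} (hD : IsSelfAdjoint D)
    (x : D.domain) : ‖D x - Complex.I • (x : E)‖ ^ 2 = ‖D x‖ ^ 2 + ‖(x : E)‖ ^ 2 := by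
  have h1 : (⟪D x, (x : E)⟫_ℂ).im = 0 := by
    rw [← Complex.conj_eq_iff_im, inner_conj_symm, inner_apply_left_of_isSelfAdjoint hD]
  rw [@norm_sub_sq ℂ, inner_smul_right, norm_smul]
  simp [h1]

/-- `D - i` is bounded below in the graph norm, and the graph is complete, so its range is closed; a
vector orthogonal to the range would be an eigenvector of `D` for `-i`. -/
theorem exists_isResolvent_I [CompleteSpace E] {D : E →ₗ.[ℂ] E} (hD : IsSelfAdjoint D) :
    ∃ Q : E →L[ℂ] E, IsResolvent D Complex.I Q := by
  have hc : IsClosed (D.graph : Set (E × E)) := hD.isClosed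
  have : CompleteSpace D.graph := hc.completeSpace_coe
  -- On its graph `D - i` becomes the bounded map `(x, Dx) ↦ Dx - ix`.
  let f : D.graph →L[ℂ] E := (ContinuousLinearMap.snd ℂ E E -
    Complex.I • ContinuousLinearMap.fst ℂ E E) ∘L D.graph.subtypeL
  have hf : ∀ g : D.graph, f g = (g : E × E).2 - Complex.I • (g : E × E).1 := fun g => rfl
  have hg : ∀ g : D.graph, ∃ x : D.domain, (x : E) = (g : E × E).1 ∧ D x = (g : E × E).2 := by
    rintro ⟨g, hg⟩
    exact (LinearPMap.mem_graph_iff D).1 hg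
  have hanti : AntilipschitzWith 1 f := by
    refine f.antilipschitz_of_bound fun g => ?_
    obtain ⟨x, h1, h2⟩ := hg g
    have h3 := norm_sq_sub_I_smul hD x
    rw [hf, ← h1, ← h2, NNReal.coe_one, one_mul]
    change ‖(g : E × E)‖ ≤ _
    rw [Prod.norm_def, ← h1, ← h2]
    refine max_le ?_ ?_ <;> refine le_of_sq_le_sq ?_ (norm_nonneg _) <;> rw [h3] <;>
      nlinarith [sq_nonneg ‖D x‖, sq_nonneg ‖(x : E)‖]
  have hclosed : IsClosed (Set.range f) := hanti.isClosed_range f.uniformContinuous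
  have hsurj : f.range = ⊤ := by
    have hcl : IsClosed (f.range : Set E) := hclosed
    have := hcl.completeSpace_coe
    rw [← Submodule.orthogonal_eq_bot_iff, Submodule.eq_bot_iff]
    intro y hy
    rw [Submodule.mem_orthogonal] at hy
    have h1 : ∀ x : D.domain, ⟪-Complex.I • y, (x : E)⟫_ℂ = ⟪y, D x⟫_ℂ := by
      intro x
      have h2 := hy _ ⟨⟨((x : E), D x), D.mem_graph x⟩, rfl⟩
      rw [inner_eq_zero_symm] at h2
      change ⟪y, D x - Complex.I • (x : E)⟫_ℂ = 0 at h2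
      rw [inner_sub_right, inner_smul_right, sub_eq_zero] at h2
      rw [h2, inner_smul_left]
      simp
    obtain ⟨hd, e⟩ := exists_apply_eq_of_isSelfAdjoint hD h1
    -- `⟪D y, y⟫` is real, but `D y = -i y` makes it `i‖y‖²`.
    have h3 : (⟪D ⟨y, hd⟩, y⟫_ℂ).im = 0 := by
      rw [← Complex.conj_eq_iff_im, inner_conj_symm]
      exact (inner_apply_left_of_isSelfAdjoint hD ⟨y, hd⟩ ⟨y, hd⟩).symm
    have h4 : ⟪y, y⟫_ℂ = ((‖y‖ ^ 2 : ℝ) : ℂ) := by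
      rw [inner_self_eq_norm_sq_to_K, Complex.ofReal_pow]
      rfl
    rw [e, inner_smul_left, h4] at h3
    rw [← norm_eq_zero]
    simpa [← Complex.ofReal_pow] using h3
  have hinj : f.ker = ⊥ := LinearMap.ker_eq_bot.2 hanti.injective
  let e := ContinuousLinearEquiv.ofBijective f hinj hsurj
  refine ⟨ContinuousLinearMap.fst ℂ E E ∘L D.graph.subtypeL ∘L e.symm.toContinuousLinearMap,
    fun u => ?_, fun x => ?_⟩
  · obtain ⟨x, h1, h2⟩ := hg (e.symm u)
    have h3 : f (e.symm u) = u := e.apply_symm_apply u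
    rw [hf, ← h1, ← h2] at h3
    change ∃ h : (e.symm u : E × E).1 ∈ D.domain, D ⟨(e.symm u : E × E).1, h⟩ -
      Complex.I • (e.symm u : E × E).1 = u
    rw [← h1]
    exact ⟨x.2, h3⟩
  · have h3 := e.symm_apply_apply ⟨((x : E), D x), D.mem_graph x⟩
    exact congrArg (fun g : D.graph => (g : E × E).1) h3

/-- Intended for `A + C = (D - z)|_K` and `R = (D - z)⁻¹`. A selfadjoint `A` always has the
resolvent `Q` at `i`, and `Q` factors through the compact `R`. -/
theorem hasCompactResolvent_of_left_inverse [CompleteSpace E] {K : Submodule ℂ E}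
    [CompleteSpace K] {A : K →ₗ.[ℂ] K} (hA : IsSelfAdjoint A) {R : E →L[ℂ] E}
    (hR : IsCompactOperator R) (C : K →L[ℂ] E)
    (h : ∀ x : A.domain, R ((A x : E) + C (x : K)) = (x : K)) : HasCompactResolvent A := by
  obtain ⟨Q, hQ⟩ := exists_isResolvent_I hA
  refine ⟨Complex.I, Q, ?_, hQ.right, hQ.left⟩
  have hcl : IsClosed (K : Set E) := (completeSpace_coe_iff_isComplete.1 ‹_›).isClosed
  -- Apply `h` to `Q u` and use `A Q u = u + i Q u`.
  have e : (fun u => (Q u : E)) = R ∘ (K.subtypeL + (C + Complex.I • K.subtypeL) ∘L Q) := by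
    funext u
    obtain ⟨hd, e⟩ := hQ.right u
    have h1 := h ⟨Q u, hd⟩
    rw [sub_eq_iff_eq_add] at e
    rw [← h1, e]
    simp only [Function.comp, add_apply, ContinuousLinearMap.comp_apply,
      smul_apply, Submodule.subtypeL_apply, Submodule.coe_add,
      Submodule.coe_smul]
    congr 1
    abel
  have h2 : IsCompactOperator (fun u => (Q u : E)) := by
    rw [e]
    exact hR.comp_clm _
  exact h2.codRestrict (fun u => (Q u).2) hcl

end Resolvent

/-! ### Sign relations of the horizontal operator -/

namespace ProjectableTriple

variable {𝒜 : Type*} [Ring 𝒜] [StarRing 𝒜] [Algebra ℂ 𝒜]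
  {H : Type*} [NormedAddCommGroup H] [InnerProductSpace ℂ H] [CompleteSpace H]
  (T : ProjectableTriple 𝒜 H)

theorem Γ_mem_domain_iff (x : H) : T.Γ x ∈ T.D.domain ↔ x ∈ T.D.domain := by
  refine ⟨fun h => ?_, T.Γ_domain x⟩
  have h1 := T.Γ_domain _ h
  rwa [T.Γ_sq] at h1

/-- The form `½(D - ΓDΓ)`, from which the (anti)commutation relations and the symmetry of `D_h` are
read off. -/
theorem Dh_apply (x : H) (hx : x ∈ T.D.domain) (hΓ : T.Γ x ∈ T.D.domain)
    (h : x ∈ T.Dh.domain) :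
    T.Dh ⟨x, h⟩ = (1 / 2 : ℂ) • (T.D ⟨x, hx⟩ - T.Γ (T.D ⟨T.Γ x, hΓ⟩)) := by
  change (1 / 2 : ℂ) • T.Γ (T.Γ (T.D ⟨x, hx⟩) - T.D ⟨T.Γ x, hΓ⟩) = _
  rw [map_sub, T.Γ_sq]

theorem D_congr {x y : H} (e : x = y) (hx : x ∈ T.D.domain) (hy : y ∈ T.D.domain) :
    T.D ⟨x, hx⟩ = T.D ⟨y, hy⟩ := by
  subst e
  rfl

theorem D_neg (x : H) (hx : x ∈ T.D.domain) (h : -x ∈ T.D.domain) :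
    T.D ⟨-x, h⟩ = -T.D ⟨x, hx⟩ :=
  T.D.map_neg ⟨x, hx⟩

theorem Dh_Γ (x : H) (hx : x ∈ T.Dh.domain) (h : T.Γ x ∈ T.Dh.domain) :
    T.Dh ⟨T.Γ x, h⟩ = -T.Γ (T.Dh ⟨x, hx⟩) := by
  have hx' : x ∈ T.D.domain := hx
  have h' : T.Γ x ∈ T.D.domain := h
  have h2 : T.Γ (T.Γ x) ∈ T.D.domain := T.Γ_domain _ h'
  rw [T.Dh_apply _ hx' h', T.Dh_apply _ h' h2, T.D_congr (T.Γ_sq _) _ hx', map_smul, map_sub,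
    T.Γ_sq, ← smul_neg, neg_sub]

theorem D_J (x : H) (hx : x ∈ T.D.domain) (h : T.J x ∈ T.D.domain) :
    T.D ⟨T.J x, h⟩ = T.J (T.D ⟨x, hx⟩) := by
  have h1 := T.isReal.real_dirac.2 ⟨x, hx⟩ h
  simpa [krEps'] using h1

theorem Dh_J (x : H) (hx : x ∈ T.Dh.domain) (h : T.J x ∈ T.Dh.domain) :
    T.Dh ⟨T.J x, h⟩ = T.J (T.Dh ⟨x, hx⟩) := by
  have hx' : x ∈ T.D.domain := hx
  have h' : T.J x ∈ T.D.domain := h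
  have h1 := T.Γ_domain _ hx'
  have h2 := (T.isReal.real_dirac.1 _).2 h1
  rw [T.Dh_apply _ hx' h1, T.Dh_apply _ h' (T.Γ_domain _ h'), T.D_congr (T.Γ_J _) _ (neg_mem h2),
    T.D_neg _ h2, T.D_J _ h1, T.D_J _ hx', map_neg, T.Γ_J, neg_neg,
    LinearIsometryEquiv.map_smulₛₗ, map_sub]
  congr 1
  simp [Complex.conj_ofNat]

theorem intertwines_γk (k : ℤ) : Intertwines (T.γk k) (T.Dk k) (T.Dk k) (-1) := by
  refine ⟨fun x => T.Γ_mem_domain_iff x, fun x h => ?_⟩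
  rw [neg_one_smul]
  exact Subtype.ext (T.Dh_Γ _ x.2 h)

theorem intertwines_jk (k m : ℤ) (hm : m = -k) :
    Intertwines (T.jk k m hm) (T.Dk k) (T.Dk m) 1 := by
  refine ⟨fun x => T.isReal.real_dirac.1 x, fun x h => ?_⟩
  rw [one_smul]
  exact Subtype.ext (T.Dh_J _ x.2 h)

theorem jk_γk (k m : ℤ) (hm : m = -k) (x : T.Hk k) :
    T.jk k m hm (T.γk k x) = -T.γk m (T.jk k m hm x) := by
  ext
  change T.J (T.Γ x) = -T.Γ (T.J x)
  rw [T.Γ_J, neg_neg]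

theorem jk_jk (k m : ℤ) (hm : m = -k) (hk : k = -m) (x : T.Hk k) :
    T.jk m k hk (T.jk k m hm x) = -x := by
  ext
  change T.J (T.J x) = -x
  simp [T.isReal.real_sq, krEps]

/-! ### Selfadjointness and compact resolvent on `H_k` -/

theorem resolvent_mem_Hk {D : H →ₗ.[ℂ] H} {z : ℂ} {R : H →L[ℂ] H} (hR : IsResolvent D z R)
    (hU : ∀ u : Circle, Intertwines (T.U u) D D 1) (k : ℤ) (x : H) (hx : x ∈ T.Hk k) :
    R x ∈ T.Hk k := by
  rw [mem_weightSpace_iff] at hx ⊢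
  intro u
  rw [← hR.apply_comm (hU u), hx u, map_smul]

theorem inner_Γ_left (x y : H) : ⟪T.Γ x, y⟫_ℂ = ⟪x, T.Γ y⟫_ℂ := by
  have h := ContinuousLinearMap.adjoint_inner_left T.Γ y x
  rwa [← ContinuousLinearMap.star_eq_adjoint, T.Γ_selfAdjoint.star_eq] at h

theorem inner_Dh_left (x y : T.Dh.domain) : ⟪T.Dh x, (y : H)⟫_ℂ = ⟪(x : H), T.Dh y⟫_ℂ := by
  obtain ⟨x, hx⟩ := x
  obtain ⟨y, hy⟩ := y
  have hx' : x ∈ T.D.domain := hx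
  have hy' : y ∈ T.D.domain := hy
  have hD := inner_apply_left_of_isSelfAdjoint T.isReal.selfAdjoint
  have h1 : ⟪T.D ⟨x, hx'⟩, y⟫_ℂ = ⟪x, T.D ⟨y, hy'⟩⟫_ℂ := hD ⟨x, hx'⟩ ⟨y, hy'⟩
  have h2 : ⟪T.D ⟨T.Γ x, T.Γ_domain x hx'⟩, T.Γ y⟫_ℂ
      = ⟪T.Γ x, T.D ⟨T.Γ y, T.Γ_domain y hy'⟩⟫_ℂ :=
    hD ⟨T.Γ x, T.Γ_domain x hx'⟩ ⟨T.Γ y, T.Γ_domain y hy'⟩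
  rw [T.Dh_apply x hx' (T.Γ_domain x hx'), T.Dh_apply y hy' (T.Γ_domain y hy'), inner_smul_left,
    inner_smul_right, inner_sub_left, inner_sub_right, h1, inner_Γ_left, h2, inner_Γ_left]
  congr 1
  simp [Complex.conj_ofNat]

section FibreLength

variable {T} {ℓ : ℝ}

/-- On `H_k` the Dirac operator is a bounded perturbation of the horizontal one. -/
theorem HasConstantFibreLength.exists_D_eq (hℓ : T.HasConstantFibreLength ℓ) (k : ℤ) :
    ∃ C : H →L[ℂ] H, ∀ (x : H) (hx : x ∈ T.D.domain) (hx' : x ∈ T.Dh.domain), x ∈ T.Hk k →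
      T.D ⟨x, hx⟩ = T.Dh ⟨x, hx'⟩ + C x := by
  obtain ⟨-, Z, hZ, -⟩ := hℓ
  -- On `H_k` the generator is the scalar `k`, so `(1/ℓ)Γδ` becomes `(k/ℓ)Γ`.
  refine ⟨((1 / ℓ : ℝ) : ℂ) • (k : ℂ) • T.Γ + Z, fun x hx hx' hk => ?_⟩
  obtain ⟨h, e⟩ := hk
  have h1 := hZ x hx h
  change _ - _ - _ • T.Γ (generator T.U ⟨x, h⟩) = _ at h1
  rw [e, map_smul] at h1
  simp only [add_apply, smul_apply]
  rw [← h1]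
  abel

/-- Adding the bounded `C` turns a vector of the adjoint domain of `D_k` into a weak solution for
`D` on `H_k`, which the resolvent of `D` places in `Dom D`. -/
theorem isSelfAdjoint_Dk (hℓ : T.HasConstantFibreLength ℓ) (k : ℤ) : IsSelfAdjoint (T.Dk k) := by
  obtain ⟨C, hC⟩ := hℓ.exists_D_eq k
  obtain ⟨z, R, -, hr, hl⟩ := T.isReal.compact_resolvent
  have hD := T.isReal.selfAdjoint
  have hR : IsResolvent T.D z R := ⟨hr, hl⟩
  have hK := T.resolvent_mem_Hk hR T.equivariant_D k
  have hK' := T.resolvent_mem_Hk (hR.adjoint hD) T.equivariant_D k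
  refine isSelfAdjoint_of_symmetric (hR.dense_domain_comap hD hK hK')
    (fun x y => T.inner_Dh_left ⟨x, x.2⟩ ⟨y, y.2⟩) fun y w h => ?_
  -- The right-hand side must lie in `H_k`. Since `C* y` is only paired with vectors of `H_k`, it
  -- may be replaced by its projection.
  let P := (T.Hk k).starProjection
  refine hR.mem_domain_of_inner hD hK hK' (w := w + P (ContinuousLinearMap.adjoint C y)) y.2
    (add_mem w.2 (Submodule.starProjection_apply_mem _ _)) fun x hx => ?_
  have hx' : (x : H) ∈ T.Dh.domain := x.2
  have h1 : ⟪T.Dh ⟨x, hx'⟩, (y : H)⟫_ℂ = ⟪(x : H), (w : H)⟫_ℂ := h ⟨⟨x, hx⟩, x.2⟩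
  have h2 : ⟪(x : H), P (ContinuousLinearMap.adjoint C y)⟫_ℂ = ⟪C x, (y : H)⟫_ℂ := by
    rw [← Submodule.inner_starProjection_left_eq_right, Submodule.starProjection_eq_self_iff.2 hx,
      ContinuousLinearMap.adjoint_inner_right]
  have h3 := congrArg (fun v => ⟪v, (y : H)⟫_ℂ) (hC x x.2 hx' hx)
  rw [inner_add_left, h1, ← h2, ← inner_add_right] at h3
  exact h3

theorem hasCompactResolvent_Dk (hℓ : T.HasConstantFibreLength ℓ) (k : ℤ) :
    HasCompactResolvent (T.Dk k) := by
  obtain ⟨C, hC⟩ := hℓ.exists_D_eq k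
  obtain ⟨z, R, hc, -, hl⟩ := T.isReal.compact_resolvent
  refine hasCompactResolvent_of_left_inverse (isSelfAdjoint_Dk hℓ k) hc
    -- With this perturbation `D_k + (C - z)` is `D - z` on `H_k`, and `R` inverts it.
    ((C - z • ContinuousLinearMap.id ℂ H) ∘L (T.Hk k).subtypeL) fun x => ?_
  refine Eq.trans (congrArg R ?_) (hl ⟨(x : T.Hk k), x.2⟩)
  refine Eq.trans ?_ (congrArg (· - z • ((x : T.Hk k) : H))
    (hC (x : T.Hk k) x.2 x.2 (x : T.Hk k).2).symm)
  exact (add_sub_assoc _ _ _).symm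

end FibreLength

/-! ### Bounded commutators and the order one condition -/

/-- The bounded commutator of the horizontal Dirac operator with an algebra element, obtained from
that of the Dirac operator. -/
def horizontal (S : H →L[ℂ] H) : H →L[ℂ] H := (1 / 2 : ℂ) • (S - T.Γ ∘L S ∘L T.Γ)

theorem Dh_commutator {a : 𝒜} {S : H →L[ℂ] H} (hS : IsCommutator T.D (T.π a) S)
    (x : H) (hx : x ∈ T.Dh.domain) (h : T.π a x ∈ T.Dh.domain) :
    T.Dh ⟨T.π a x, h⟩ - T.π a (T.Dh ⟨x, hx⟩) = T.horizontal S x := by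
  have hx' : x ∈ T.D.domain := hx
  have hΓ := T.Γ_domain x hx'
  obtain ⟨h1, e1⟩ := hS ⟨x, hx'⟩
  obtain ⟨h2, e2⟩ := hS ⟨T.Γ x, hΓ⟩
  have h3 := T.Γ_domain _ h1
  change _ = (1 / 2 : ℂ) • (S x - T.Γ (S (T.Γ x)))
  rw [T.Dh_apply _ h1 h3, T.Dh_apply _ hx' hΓ, ← e1, ← e2, T.D_congr (T.Γ_comm a x) h3 h2,
    map_smul, map_sub, map_sub, T.Γ_comm, ← smul_sub]
  congr 1
  abel

/-- `Γ` anticommutes with both `J` and `J⁻¹`; the two signs cancel. -/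
theorem Γ_opposite (a : 𝒜) (x : H) :
    T.Γ (T.J (T.π a (T.J.symm x))) = T.J (T.π a (T.J.symm (T.Γ x))) := by
  have h1 : T.J.symm (T.Γ x) = -T.Γ (T.J.symm x) := by
    rw [LinearIsometryEquiv.symm_apply_eq, map_neg, ← T.Γ_J, LinearIsometryEquiv.apply_symm_apply]
  rw [h1, T.Γ_J, T.Γ_comm, map_neg, map_neg]

variable [StarModule ℂ 𝒜]

theorem exists_isCommutator_Dk (b : T.invariants) (k : ℤ) :
    ∃ S : T.Hk k →L[ℂ] T.Hk k, IsCommutator (T.Dk k) (T.πk k b) S := by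
  obtain ⟨S, hS⟩ := T.isReal.bounded_commutator b
  -- The projection only serves to land in `H_k`: on the domain of `D_k` the value is already there,
  -- being a commutator of operators that preserve `H_k`.
  refine ⟨(T.Hk k).orthogonalProjectionOnto ∘L T.horizontal S ∘L (T.Hk k).subtypeL, fun x => ?_⟩
  have h := (hS ⟨(x : T.Hk k), x.2⟩).1
  refine ⟨h, ?_⟩
  have h1 := T.Dh_commutator hS (x : T.Hk k) x.2 h
  change _ = (T.Hk k).orthogonalProjectionOnto (T.horizontal S (x : T.Hk k))
  rw [← h1]
  exact (Submodule.orthogonalProjectionOnto_mem_subspace_eq_self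
    (T.Dk k ⟨T.πk k b x, h⟩ - T.πk k b (T.Dk k x))).symm

/-- The order one condition concerns every bounded extension of the commutator. Two continuous maps
that agree on the dense domain coincide, so each such extension is given by the explicit formula. -/
theorem coe_commutator_Dk {k : ℤ} (hk : Dense ((T.Dk k).domain : Set (T.Hk k)))
    {b : T.invariants} {S : H →L[ℂ] H} (hS : IsCommutator T.D (T.π (b : 𝒜)) S)
    {S' : T.Hk k →L[ℂ] T.Hk k} (hS' : IsCommutator (T.Dk k) (T.πk k b) S') (x : T.Hk k) :
    (S' x : H) = T.horizontal S x := by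
  have h : (fun x => (S' x : H)) = fun x : T.Hk k => T.horizontal S x := by
    refine Continuous.ext_on hk (by fun_prop) (by fun_prop) fun x hx => ?_
    obtain ⟨h, e⟩ := hS' ⟨x, hx⟩
    exact (congrArg Subtype.val e).symm.trans (T.Dh_commutator hS x hx h)
  exact congrFun h x

theorem commutant_πk (k m : ℤ) (hk : k = -m) (a b : T.invariants) (x : T.Hk k) :
    T.πk k a (T.jk m k hk (T.πk m (star b) ((T.jk m k hk).symm x)))
      = T.jk m k hk (T.πk m (star b) ((T.jk m k hk).symm (T.πk k a x))) :=
  Subtype.ext (T.isReal.commutant a b x)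

/-- Both `[D, a]` and `Γ` commute with `J b* J⁻¹`, hence so does `½([D, a] - Γ[D, a]Γ)`. -/
theorem order_one_Dk {k m : ℤ} (hd : Dense ((T.Dk k).domain : Set (T.Hk k))) (hk : k = -m)
    (a b : T.invariants) (S : T.Hk k →L[ℂ] T.Hk k) (hS : IsCommutator (T.Dk k) (T.πk k a) S)
    (x : T.Hk k) :
    S (T.jk m k hk (T.πk m (star b) ((T.jk m k hk).symm x)))
      = T.jk m k hk (T.πk m (star b) ((T.jk m k hk).symm (S x))) := by
  obtain ⟨S₀, hS₀⟩ := T.isReal.bounded_commutator a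
  have h1 := T.isReal.order_one a b S₀ hS₀
  have h2 := T.Γ_opposite (star (b : 𝒜))
  ext
  rw [T.coe_commutator_Dk hd hS₀ hS]
  change T.horizontal S₀ (T.J (T.π (star b : 𝒜) (T.J.symm (x : H))))
    = T.J (T.π (star b : 𝒜) (T.J.symm (S x)))
  rw [T.coe_commutator_Dk hd hS₀ hS]
  change (1 / 2 : ℂ) • (S₀ _ - T.Γ (S₀ (T.Γ _)))
    = T.J (T.π (star b : 𝒜) (T.J.symm ((1 / 2 : ℂ) • (S₀ _ - T.Γ (S₀ (T.Γ _))))))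
  rw [h2, h1, h1, h2, LinearIsometryEquiv.map_smulₛₗ, map_smul, LinearIsometryEquiv.map_smulₛₗ,
    map_sub, map_sub, map_sub]
  congr 1
  simp

/-! ### Assembly of the spectral triples -/

variable {T} {ℓ : ℝ}

theorem isEvenSpectralTriple_Dk (hℓ : T.HasConstantFibreLength ℓ) (k : ℤ) :
    IsEvenSpectralTriple (T.πk k) (T.Dk k) (T.γk k) where
  dense_domain := (isSelfAdjoint_Dk hℓ k).dense_domain
  selfAdjoint := isSelfAdjoint_Dk hℓ k
  compact_resolvent := hasCompactResolvent_Dk hℓ k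
  bounded_commutator b := T.exists_isCommutator_Dk b k
  grading_selfAdjoint := by
    rw [ContinuousLinearMap.isSelfAdjoint_iff_isSymmetric]
    exact fun x y => T.inner_Γ_left x y
  grading_sq x := Subtype.ext (T.Γ_sq x)
  grading_comm a x := Subtype.ext (T.Γ_comm a x)
  grading_anticomm := T.intertwines_γk k

/-- Keeping `m` as a variable with `m = -k` and `k = -m` allows `k = m = 0`, with no transport
between `H_0` and `H_{-0}`. -/
theorem isPairwiseReal_Dk (hℓ : T.HasConstantFibreLength ℓ) (k m : ℤ) (hm : m = -k) (hk : k = -m) :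
    IsPairwiseReal 2 (T.πk k) (T.Dk k) (T.γk k) (T.πk m) (T.Dk m) (T.γk m)
      (T.jk k m hm) (T.jk m k hk) where
  even_left := isEvenSpectralTriple_Dk hℓ k
  even_right := isEvenSpectralTriple_Dk hℓ m
  even_dim := even_two
  real_sq_left x := by simp [T.jk_jk, krEps]
  real_sq_right x := by simp [T.jk_jk, krEps]
  real_dirac_left := T.intertwines_jk k m hm
  real_dirac_right := T.intertwines_jk m k hk
  real_grading_left x := by simp [T.jk_γk, krEps'']
  real_grading_right x := by simp [T.jk_γk, krEps'']
  commutant_left := T.commutant_πk k m hk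
  commutant_right := T.commutant_πk m k hm
  order_one_left := T.order_one_Dk (isSelfAdjoint_Dk hℓ k).dense_domain hk
  order_one_right := T.order_one_Dk (isSelfAdjoint_Dk hℓ m).dense_domain hm

/-- Pairwise reality of a triple with itself, through one and the same antiunitary, is reality. -/
theorem isEvenRealSpectralTriple_Dk_zero (hℓ : T.HasConstantFibreLength ℓ) :
    IsEvenRealSpectralTriple 2 (T.πk 0) (T.Dk 0) (T.γk 0) (T.jk 0 0 neg_zero.symm) :=
  have h := isPairwiseReal_Dk hℓ 0 0 neg_zero.symm neg_zero.symm
  { h.even_left with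
    real_sq := h.real_sq_left
    real_dirac := h.real_dirac_left
    commutant := h.commutant_left
    order_one := h.order_one_left
    even_dim := h.even_dim
    real_grading := h.real_grading_left }

end ProjectableTriple

end NCBundle

end

theorem mainTheorem1 {𝒜 : Type*} [Ring 𝒜] [StarRing 𝒜] [Algebra ℂ 𝒜] [StarModule ℂ 𝒜]
    {H : Type*} [NormedAddCommGroup H] [InnerProductSpace ℂ H] [CompleteSpace H]
    (T : NCBundle.ProjectableTriple 𝒜 H) (ℓ : ℝ) (hℓ : T.HasConstantFibreLength ℓ) :
    (∀ k : ℤ,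
      NCBundle.Intertwines (T.γk k) (T.Dk k) (T.Dk k) (-1) ∧
      NCBundle.Intertwines (T.jk k (-k) rfl) (T.Dk k) (T.Dk (-k)) 1 ∧
      ∀ x : T.Hk k, T.jk k (-k) rfl (T.γk k x) = -T.γk (-k) (T.jk k (-k) rfl x)) ∧
    NCBundle.IsEvenRealSpectralTriple 2 (T.πk 0) (T.Dk 0) (T.γk 0) (T.jk 0 0 neg_zero.symm) ∧
    ∀ k : ℤ, k ≠ 0 →
      NCBundle.IsEvenSpectralTriple (T.πk k) (T.Dk k) (T.γk k) ∧
      NCBundle.IsPairwiseReal 2 (T.πk k) (T.Dk k) (T.γk k)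
        (T.πk (-k)) (T.Dk (-k)) (T.γk (-k))
        (T.jk k (-k) rfl) (T.jk (-k) k (neg_neg k).symm) := by
  exact ⟨fun k => ⟨T.intertwines_γk k, T.intertwines_jk k (-k) rfl, T.jk_γk k (-k) rfl⟩,
    NCBundle.ProjectableTriple.isEvenRealSpectralTriple_Dk_zero hℓ,
    fun k _ => ⟨NCBundle.ProjectableTriple.isEvenSpectralTriple_Dk hℓ k,
      NCBundle.ProjectableTriple.isPairwiseReal_Dk hℓ k (-k) rfl (neg_neg k).symm⟩⟩
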